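/- Let $n,\ell\ge 1$, and let $x_1,\dots,x_n,z_1,\dots,z_\ell$ be invertible commuting variables (formal Laurent variables, or more generally arbitrary units of an arbitrary commutative ring). For a partition $\lambda$, a King tableau of shape $\lambda$ for $\mathrm{Sp}_{2\ell}$ is a filling of the Young diagram of $\lambda$ with letters from $1<\overline{1}<2<\overline{2}<\cdots<\ell<\overline{\ell}$ which is weakly increasing along rows from left to right, strictly increasing down columns, and such that every entry of the $i$-th row is at least $i$. Put $$sp_\lambda(z_1,\dots,z_\ell)=\sum_{K}\ \prod_{i=1}^{\ell} z_i^{\,m_i(K)-m_{\overline{i}}(K)},$$ where $K$ runs over the King tableaux of shape $\lambda$ for $\mathrm{Sp}_{2\ell}$, and $m_a(K)$ is the number of occurrences of the letter $a$ in $K$; define $sp_\lambda(x_1,\dots,x_n)$ in the same way with $n$ in place of $\ell$. For $\lambda=(\lambda_1,\dots,\lambda_\ell)\subseteq(n^\ell)$ let $$\rho_n(\lambda,\ell)=(n-\lambda_\ell,\,n-\lambda_{\ell-1},\,\dots,\,n-\lambda_1)'$$ be the conjugate of the complement of $\lambda$ in the rectangle $(n^\ell)$ with $\ell$ rows and $n$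 columns. Then $$\prod_{i=1}^{n}\prod_{j=1}^{\ell}\bigl(x_i+x_i^{-1}+z_j+z_j^{-1}\bigr)=\sum_{\lambda\subseteq(n^\ell)} sp_{\rho_n(\lambda,\ell)}(x_1,\dots,x_n)\; sp_\lambda(z_1,\dots,z_\ell).$$ -/

import Mathlib

namespace SymplecticCauchy

/-- The rectangular Young diagram `(n^ℓ)`, with `ℓ` rows of length `n`. -/
def rect (ℓ n : ℕ) : YoungDiagram where
  cells := Finset.range ℓ ×ˢ Finset.range n
  isLowerSet := by
    rintro ⟨i, j⟩ ⟨i', j'⟩ ⟨hi, hj⟩ h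
    simp only [Finset.coe_product, Finset.coe_range, Set.mem_prod, Set.mem_Iio] at h ⊢
    exact ⟨lt_of_le_of_lt hi h.1, lt_of_le_of_lt hj h.2⟩

/-- The rectangular complement of `μ` in `(n^ℓ)`: the partition
`(n - μ_ℓ, n - μ_{ℓ-1}, …, n - μ_1)`.
Rows are numbered from `0`, so that row `i` has length `n - μ.rowLen (ℓ - 1 - i)`. -/
def rectComplement (ℓ n : ℕ) (μ : YoungDiagram) : YoungDiagram where
  cells := (Finset.range ℓ ×ˢ Finset.range n).filter
    fun c => c.2 < n - μ.rowLen (ℓ - 1 - c.1)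
  isLowerSet := by
    rintro ⟨i, j⟩ ⟨i', j'⟩ ⟨hi, hj⟩ h
    simp only [Finset.coe_filter, Finset.mem_product, Finset.mem_range, Set.mem_ofPred_eq] at h ⊢
    have hi' : i' ≤ i := hi
    have hj' : j' ≤ j := hj
    have hr := μ.rowLen_anti (ℓ - 1 - i) (ℓ - 1 - i') (by omega)
    omega

/-- `ρ_n(μ, ℓ)`: the conjugate of the rectangular complement of `μ` in `(n^ℓ)`. -/
def rho (n : ℕ) (μ : YoungDiagram) (ℓ : ℕ) : YoungDiagram :=
  (rectComplement ℓ n μ).transpose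

theorem rectComplement_rowLen {ℓ n : ℕ} (μ : YoungDiagram) {i : ℕ} (hi : i < ℓ) :
    (rectComplement ℓ n μ).rowLen i = n - μ.rowLen (ℓ - 1 - i) := by
  refine eq_of_forall_lt_iff fun j => ?_
  rw [← YoungDiagram.mem_iff_lt_rowLen, ← YoungDiagram.mem_cells]
  simp only [rectComplement, Finset.mem_filter, Finset.mem_product, Finset.mem_range]
  omega

/-- Semistandard tableaux here have entries in `ℕ`. The alphabet `1 < 1̄ < 2 < 2̄ < ⋯ < ℓ < ℓ̄`
is identified, as an ordered set, with `{0, 1, …, 2ℓ - 1}`: the letter `k + 1` is coded by `2k` and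
the letter `k + 1` with a bar is coded by `2k + 1`. A King tableau is a semistandard tableau in this
alphabet whose entries in row `i` (rows numbered from `1`) are at least the letter `i`. With rows
numbered from `0`, as here, this means that the codes in row `i` are at least `2i`. -/
def IsKing (ℓ : ℕ) {μ : YoungDiagram} (T : SemistandardYoungTableau μ) : Prop :=
  ∀ i j, (i, j) ∈ μ → 2 * i ≤ T i j ∧ T i j < 2 * ℓ

/-- The set of King tableaux of shape `μ` for `Sp_{2ℓ}`. -/
def KingTableau (ℓ : ℕ) (μ : YoungDiagram) : Type :=
  {T : SemistandardYoungTableau μ // IsKing ℓ T}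

instance (ℓ : ℕ) (μ : YoungDiagram) : Finite (KingTableau ℓ μ) := by
  let f : KingTableau ℓ μ → (μ.cells → Fin (2 * ℓ)) := fun T c =>
    ⟨T.1 c.1.1 c.1.2, (T.2 _ _ ((YoungDiagram.mem_cells c.1).1 c.2)).2⟩
  refine Finite.of_injective f fun S T h => Subtype.ext (SemistandardYoungTableau.ext fun i j => ?_)
  by_cases hc : (i, j) ∈ μ
  · exact congrArg Fin.val (congrFun h ⟨(i, j), (YoungDiagram.mem_cells _).2 hc⟩)
  · rw [S.1.zeros hc, T.1.zeros hc]

noncomputable instance (ℓ : ℕ) (μ : YoungDiagram) : Fintype (KingTableau ℓ μ) :=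
  Fintype.ofFinite _

instance (μ : YoungDiagram) : Finite {ν : YoungDiagram // ν ≤ μ} := by
  let f : {ν : YoungDiagram // ν ≤ μ} → {s : Finset (ℕ × ℕ) // s ∈ μ.cells.powerset} :=
    fun ν => ⟨ν.1.cells, Finset.mem_powerset.2 (YoungDiagram.cells_subset_iff.2 ν.2)⟩
  refine Finite.of_injective f fun a b h => Subtype.ext (YoungDiagram.ext ?_)
  exact congrArg Subtype.val h

noncomputable instance (μ : YoungDiagram) : Fintype {ν : YoungDiagram // ν ≤ μ} :=
  Fintype.ofFinite _

/-- The number of occurrences of the letter with code `k` in `T`. -/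
def mult {μ : YoungDiagram} (T : SemistandardYoungTableau μ) (k : ℕ) : ℕ :=
  (μ.cells.filter fun c => T c.1 c.2 = k).card

/-- `z^T = ∏ z_i ^ (m_i - m_ī)`, where `m_i` and `m_ī` are the numbers of occurrences of the
letters `i` and `ī` in `T`. -/
def weight {R : Type*} [CommRing R] {ℓ : ℕ} (z : Fin ℓ → Rˣ) {μ : YoungDiagram}
    (T : SemistandardYoungTableau μ) : Rˣ :=
  ∏ i : Fin ℓ, z i ^ ((mult T (2 * i) : ℤ) - (mult T (2 * i + 1) : ℤ))

/-- The symplectic character `sp_μ(z_1, …, z_ℓ)`, the generating function of King tableaux. -/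
noncomputable def sp {R : Type*} [CommRing R] {ℓ : ℕ} (μ : YoungDiagram) (z : Fin ℓ → Rˣ) : R :=
  ∑ T : KingTableau ℓ μ, (weight z T.1 : R)

end SymplecticCauchy

/-!
The identity is the expansion of a resultant. Put `t_i = x_i + x_i⁻¹` and `s_j = z_j + z_j⁻¹`. The
left-hand side `∏ (t_i + s_j)` is the resultant of `q = ∏ (X - t_i)` and `p = ∏ (X + s_j)`, that is,
the determinant of the `n + ℓ` polynomials `p X ^ j` (`j < n`), `q X ^ i` (`i < ℓ`) in the basis of
monomials. A unitriangular change of basis replaces `X ^ k` by the Chebyshev polynomial `S k`, which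
satisfies `X S_k = S_{k+1} + S_{k-1}` and `S_{-1} = 0` (`coeffDet_mul_S`, `resultant_prod_eq`).

Multiplication by `X + z + z⁻¹` is the composite `S_c ↦ (z + shift) (1 + z⁻¹ shift⁻¹) S_c` of two
bidiagonal operators. On a wedge product `S_{c_0} ∧ ⋯ ∧ S_{c_{n-1}}`, whose exponents
`c_j = i + j - λ'_j` encode the columns of a diagram `λ`, each of the two operators adds a
horizontal strip to `λ` in all possible ways, and its terms that are not of this form vanish because
two exponents coincide (`map_add_smul_shift`). A semistandard tableau is the same as a chain of
horizontal strips (`kingSum_succ`), and the relation `S_{-1} = 0` kills exactly the chains that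
violate the King condition (`sum_kingSum_succ`). Hence
`p S_0 ∧ ⋯ ∧ p S_{n-1} = ∑ λ, sp_λ(z) S_{c(λ)}` (`map_prod_mul_eq_sum_kingSum`).

This is applied to both blocks of the determinant, with `-X` and `(-1) ^ c S_c` in place of `X` and
`S_c` in the second one. What remains are determinants of Chebyshev polynomials whose exponents come
from a pair `(λ, ρ)`. Such a determinant is nonzero only if the two sets of exponents are
complementary in `{0, …, n + ℓ - 1}`, which means that `ρ = rho n λ ℓ`. The sign of the resulting
shuffle is `(-1) ^ |ρ|` (`coeffDet_S_colExponent`), and it cancels against the signs of the second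
block.
-/

namespace SymplecticCauchy

open Finset

/-! ### Tableaux and horizontal strips -/

/-- `μ / ν` is a horizontal strip: `ν ⊆ μ`, and no two cells of `μ` outside `ν` lie in the same
column. -/
def IsHorizontalStrip (ν μ : YoungDiagram) : Prop :=
  ν ≤ μ ∧ ∀ i j, (i + 1, j) ∈ μ → (i, j) ∈ ν

/-- Semistandard tableaux of shape `μ` with letters (codes) below `k` that satisfy the King
condition. Allowing odd `k` makes it possible to remove one letter at a time. -/
def KingTableauBelow (k : ℕ) (μ : YoungDiagram) : Type :=
  {T : SemistandardYoungTableau μ // ∀ i j, (i, j) ∈ μ → 2 * i ≤ T i j ∧ T i j < k}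

instance (k : ℕ) (μ : YoungDiagram) : Finite (KingTableauBelow k μ) := by
  let f : KingTableauBelow k μ → KingTableau k μ :=
    fun T => ⟨T.1, fun i j h => ⟨(T.2 i j h).1, (T.2 i j h).2.trans_le (by omega)⟩⟩
  exact Finite.of_injective f fun S T h =>
    Subtype.ext (congrArg (fun U : KingTableau k μ => U.1) h)

noncomputable instance (k : ℕ) (μ : YoungDiagram) : Fintype (KingTableauBelow k μ) :=
  Fintype.ofFinite _

/-- The generating function of `KingTableauBelow k μ`, where the letter with code `a` has
weight `w a`. -/
noncomputable def kingSum {R : Type*} [CommSemiring R] (w : ℕ → R) (k : ℕ) (μ : YoungDiagram) :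
    R :=
  ∑ T : KingTableauBelow k μ, ∏ c ∈ μ.cells, w (T.1 c.1 c.2)

/-- The cells of a tableau whose entries are less than `k`. -/
def truncShape {μ : YoungDiagram} (T : SemistandardYoungTableau μ) (k : ℕ) : YoungDiagram where
  cells := μ.cells.filter fun c => T c.1 c.2 < k
  isLowerSet := by
    rintro ⟨i, j⟩ ⟨i', j'⟩ ⟨hi, hj⟩ h
    simp only [coe_filter, YoungDiagram.mem_cells, Set.mem_ofPred_eq] at h ⊢
    have hi' : i' ≤ i := hi
    have hj' : j' ≤ j := hj
    exact ⟨μ.up_left_mem hi' hj' h.1, ((T.row_weak_of_le hj'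
      (μ.up_left_mem hi' le_rfl h.1)).trans (T.col_weak hi' h.1)).trans_lt h.2⟩

theorem mem_truncShape {μ : YoungDiagram} {T : SemistandardYoungTableau μ} {k : ℕ} {c : ℕ × ℕ} :
    c ∈ truncShape T k ↔ c ∈ μ ∧ T c.1 c.2 < k := by
  rw [← YoungDiagram.mem_cells]
  simp [truncShape]

theorem isHorizontalStrip_truncShape {μ : YoungDiagram} {k : ℕ}
    (T : KingTableauBelow (k + 1) μ) : IsHorizontalStrip (truncShape T.1 k) μ := by
  refine ⟨fun c hc => (mem_truncShape.1 hc).1, fun i j h => mem_truncShape.2 ?_⟩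
  have h1 := (T.2 _ _ h).2
  have h2 := T.1.col_strict (Nat.lt_add_one i) h
  exact ⟨μ.up_left_mem (Nat.le_succ i) le_rfl h, by dsimp only; omega⟩

/-- The subtableau of the entries less than `k`. -/
def restrictTableau {ν μ : YoungDiagram} {k : ℕ} (T : KingTableauBelow (k + 1) μ)
    (h : truncShape T.1 k = ν) : KingTableauBelow k ν where
  val :=
    { entry := fun i j => if (i, j) ∈ ν then T.1 i j else 0
      row_weak' := by
        intro i j1 j2 hj hc
        rw [if_pos hc, if_pos (ν.up_left_mem le_rfl hj.le hc)]
        exact T.1.row_weak hj (mem_truncShape.1 (h ▸ hc)).1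
      col_strict' := by
        intro i1 i2 j hi hc
        rw [if_pos hc, if_pos (ν.up_left_mem hi.le le_rfl hc)]
        exact T.1.col_strict hi (mem_truncShape.1 (h ▸ hc)).1
      zeros' := fun hc => if_neg hc }
  property := by
    intro i j hc
    have hc' := mem_truncShape.1 (h ▸ hc)
    change 2 * i ≤ (if (i, j) ∈ ν then T.1 i j else 0) ∧ (if (i, j) ∈ ν then T.1 i j else 0) < k
    rw [if_pos hc]
    exact ⟨(T.2 i j hc'.1).1, hc'.2⟩

theorem restrictTableau_apply {ν μ : YoungDiagram} {k : ℕ} (T : KingTableauBelow (k + 1) μ)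
    (h : truncShape T.1 k = ν) (i j : ℕ) :
    (restrictTableau T h).1 i j = if (i, j) ∈ ν then T.1 i j else 0 := rfl

/-- Fill the cells of a horizontal strip with the letter `k`. The bound on the number of rows is
the King condition for the new cells. -/
def extendTableau {ν μ : YoungDiagram} {k : ℕ} (T : KingTableauBelow k ν)
    (h : IsHorizontalStrip ν μ) (hr : 2 * μ.colLen 0 ≤ k + 2) : KingTableauBelow (k + 1) μ where
  val :=
    { entry := fun i j => if (i, j) ∈ ν then T.1 i j else if (i, j) ∈ μ then k else 0
      row_weak' := by
        intro i j1 j2 hj hc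
        have hc1 := μ.up_left_mem le_rfl hj.le hc
        by_cases h2 : (i, j2) ∈ ν
        · rw [if_pos h2, if_pos (ν.up_left_mem le_rfl hj.le h2)]
          exact T.1.row_weak hj h2
        · rw [if_neg h2, if_pos hc, if_pos hc1]
          split_ifs with h1
          · exact (T.2 _ _ h1).2.le
          · exact le_rfl
      col_strict' := by
        intro i1 i2 j hi hc
        have h1 : (i1, j) ∈ ν := h.2 _ _ (μ.up_left_mem (Nat.succ_le_of_lt hi) le_rfl hc)
        rw [if_pos h1, if_pos hc]
        split_ifs with h2
        · exact T.1.col_strict hi h2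
        · exact (T.2 _ _ h1).2
      zeros' := fun {i j} hc => by
        rw [if_neg fun h' => hc (h.1 h'), if_neg hc] }
  property := by
    intro i j hc
    change 2 * i ≤ (if (i, j) ∈ ν then T.1 i j else if (i, j) ∈ μ then k else 0) ∧
      (if (i, j) ∈ ν then T.1 i j else if (i, j) ∈ μ then k else 0) < k + 1
    rw [if_pos hc]
    have hi : i < μ.colLen 0 :=
      YoungDiagram.mem_iff_lt_colLen.1 (μ.up_left_mem le_rfl (Nat.zero_le j) hc)
    split_ifs with h1
    · exact ⟨(T.2 _ _ h1).1, (T.2 _ _ h1).2.trans (Nat.lt_succ_self k)⟩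
    · omega

theorem extendTableau_apply {ν μ : YoungDiagram} {k : ℕ} (T : KingTableauBelow k ν)
    (h : IsHorizontalStrip ν μ) (hr : 2 * μ.colLen 0 ≤ k + 2) (i j : ℕ) :
    (extendTableau T h hr).1 i j =
      if (i, j) ∈ ν then T.1 i j else if (i, j) ∈ μ then k else 0 := rfl

theorem truncShape_extendTableau {ν μ : YoungDiagram} {k : ℕ} (T : KingTableauBelow k ν)
    (h : IsHorizontalStrip ν μ) (hr : 2 * μ.colLen 0 ≤ k + 2) :
    truncShape (extendTableau T h hr).1 k = ν := by
  refine SetLike.ext fun c => ?_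
  rw [mem_truncShape, extendTableau_apply]
  refine ⟨fun hc => ?_, fun hc => ⟨h.1 hc, ?_⟩⟩
  · by_contra hn
    rw [if_neg hn, if_pos hc.1] at hc
    exact lt_irrefl _ hc.2
  · rw [if_pos hc]
    exact (T.2 _ _ hc).2

theorem colLen_le_of_kingTableauBelow {μ : YoungDiagram} {k : ℕ} (T : KingTableauBelow k μ) :
    2 * μ.colLen 0 ≤ k + 1 := by
  by_contra hlt
  have hm : (μ.colLen 0 - 1, 0) ∈ μ := YoungDiagram.mem_iff_lt_colLen.2 (by omega)
  have := T.2 _ _ hm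
  omega

theorem kingSum_eq_zero {R : Type*} [CommSemiring R] (w : ℕ → R) {k : ℕ} {μ : YoungDiagram}
    (h : k + 1 < 2 * μ.colLen 0) : kingSum w k μ = 0 := by
  have : IsEmpty (KingTableauBelow k μ) :=
    ⟨fun T => absurd (colLen_le_of_kingTableauBelow T) (by omega)⟩
  exact Fintype.sum_empty _

theorem kingSum_zero_bot {R : Type*} [CommSemiring R] (w : ℕ → R) :
    kingSum w 0 ⊥ = 1 := by
  have : Unique (KingTableauBelow 0 ⊥) :=
    { default := ⟨SemistandardYoungTableau.highestWeight ⊥,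
        fun i j h => absurd h (YoungDiagram.notMem_bot _)⟩
      uniq := fun T => Subtype.ext (SemistandardYoungTableau.ext fun i j => by
        rw [T.1.zeros (YoungDiagram.notMem_bot _),
          SemistandardYoungTableau.zeros _ (YoungDiagram.notMem_bot _)]) }
  rw [kingSum, Fintype.sum_unique]
  simp

open Classical in
/-- Branching: removing the letter `k` from a tableau leaves a tableau on a shape that differs
from the original one by a horizontal strip. -/
theorem kingSum_succ {R : Type*} [CommSemiring R] (w : ℕ → R) {k : ℕ} {μ : YoungDiagram}
    (hr : 2 * μ.colLen 0 ≤ k + 2) {B : Finset YoungDiagram} (hB : ∀ ν ≤ μ, ν ∈ B) :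
    kingSum w (k + 1) μ =
      ∑ ν ∈ B, if IsHorizontalStrip ν μ then w k ^ #(μ.cells \ ν.cells) * kingSum w k ν else 0 := by
  rw [kingSum, ← sum_fiberwise_of_maps_to (t := B)
    (g := fun T : KingTableauBelow (k + 1) μ => truncShape T.1 k)
    fun T _ => hB _ (isHorizontalStrip_truncShape T).1]
  refine sum_congr rfl fun ν _ => ?_
  split_ifs with h
  · rw [kingSum, mul_sum]
    refine sum_bij' (fun T hT => restrictTableau T (mem_filter.1 hT).2)
      (fun T _ => extendTableau T h hr) (fun _ _ => mem_univ _)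
      (fun T _ => mem_filter.2 ⟨mem_univ _, truncShape_extendTableau T h hr⟩) ?_ ?_ ?_
    · intro T hT
      have hν := (mem_filter.1 hT).2
      refine Subtype.ext (SemistandardYoungTableau.ext fun i j => ?_)
      rw [extendTableau_apply, restrictTableau_apply]
      split_ifs with h1 h2
      · rfl
      · have h3 : ¬ T.1 i j < k := fun h3 => h1 (hν ▸ mem_truncShape.2 ⟨h2, h3⟩)
        have h4 := (T.2 _ _ h2).2
        omega
      · exact (T.1.zeros h2).symm
    · intro T _
      refine Subtype.ext (SemistandardYoungTableau.ext fun i j => ?_)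
      rw [restrictTableau_apply, extendTableau_apply]
      split_ifs with h1
      · rfl
      · exact (T.1.zeros h1).symm
    · intro T hT
      have hν := (mem_filter.1 hT).2
      have hsub : ν.cells ⊆ μ.cells := YoungDiagram.cells_subset_iff.2 h.1
      rw [← prod_sdiff hsub]
      congr 1
      · rw [← prod_const]
        refine prod_congr rfl fun c hc => ?_
        rw [mem_sdiff, YoungDiagram.mem_cells, YoungDiagram.mem_cells] at hc
        have h3 : ¬ T.1 c.1 c.2 < k := fun h3 => hc.2 (hν ▸ mem_truncShape.2 ⟨hc.1, h3⟩)
        have h4 := (T.2 c.1 c.2 hc.1).2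
        rw [show T.1 c.1 c.2 = k by omega]
      · refine prod_congr rfl fun c hc => ?_
        rw [restrictTableau_apply, if_pos ((YoungDiagram.mem_cells c).1 hc)]
  · rw [filter_eq_empty_iff.2, sum_empty]
    rintro T _ rfl
    exact h (isHorizontalStrip_truncShape T)

/-- The weights of the codes `0, 1, 2, …`: `z_i` for the code `2i` and `z_i⁻¹` for the code
`2i + 1`. Codes outside the alphabet get weight `1`. -/
def letterWeight {G : Type*} [Group G] {ℓ : ℕ} (z : Fin ℓ → G) (a : ℕ) : G :=
  if h : a / 2 < ℓ then (if a % 2 = 0 then z ⟨a / 2, h⟩ else (z ⟨a / 2, h⟩)⁻¹) else 1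

theorem letterWeight_two_mul {G : Type*} [Group G] {ℓ : ℕ} (z : Fin ℓ → G) (i : Fin ℓ) :
    letterWeight z (2 * i) = z i := by
  simp [letterWeight]

theorem letterWeight_two_mul_add_one {G : Type*} [Group G] {ℓ : ℕ} (z : Fin ℓ → G) (i : Fin ℓ) :
    letterWeight z (2 * i + 1) = (z i)⁻¹ := by
  have h : (2 * (i : ℕ) + 1) / 2 = i := by omega
  simp [letterWeight, h, Nat.add_mod]

theorem letterWeight_mul_succ {G : Type*} [Group G] {ℓ : ℕ} (z : Fin ℓ → G) (i : ℕ) :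
    letterWeight z (2 * i) * letterWeight z (2 * i + 1) = 1 := by
  by_cases h : i < ℓ
  · rw [letterWeight_two_mul z ⟨i, h⟩, letterWeight_two_mul_add_one z ⟨i, h⟩, mul_inv_cancel]
  · have h1 : 2 * i / 2 = i := by omega
    have h2 : (2 * i + 1) / 2 = i := by omega
    simp [letterWeight, h1, h2, h]

theorem prod_range_two_mul {G : Type*} [CommMonoid G] (f : ℕ → G) (m : ℕ) :
    ∏ a ∈ range (2 * m), f a = ∏ i ∈ range m, f (2 * i) * f (2 * i + 1) := by
  induction m with
  | zero => simp
  | succ m ih =>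
    rw [show 2 * (m + 1) = 2 * m + 1 + 1 by ring, prod_range_succ, prod_range_succ, ih,
      prod_range_succ, mul_assoc]

theorem weight_eq_prod_letterWeight {R : Type*} [CommRing R] {ℓ : ℕ} (z : Fin ℓ → Rˣ)
    {μ : YoungDiagram} (T : KingTableauBelow (2 * ℓ) μ) :
    weight z T.1 = ∏ c ∈ μ.cells, letterWeight z (T.1 c.1 c.2) := by
  rw [← prod_fiberwise_of_maps_to (t := range (2 * ℓ)) (g := fun c : ℕ × ℕ => T.1 c.1 c.2)
    fun c hc => mem_range.2 (T.2 c.1 c.2 ((YoungDiagram.mem_cells c).1 hc)).2]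
  have h : ∀ a ∈ range (2 * ℓ), ∏ c ∈ μ.cells with T.1 c.1 c.2 = a, letterWeight z (T.1 c.1 c.2) =
      letterWeight z a ^ mult T.1 a := by
    intro a _
    rw [mult, ← prod_const]
    exact prod_congr rfl fun c hc => by rw [(mem_filter.1 hc).2]
  rw [prod_congr rfl h, prod_range_two_mul, ← Fin.prod_univ_eq_prod_range
    (fun i => letterWeight z (2 * i) ^ mult T.1 (2 * i) *
      letterWeight z (2 * i + 1) ^ mult T.1 (2 * i + 1)), weight]
  refine prod_congr rfl fun i _ => ?_
  rw [letterWeight_two_mul, letterWeight_two_mul_add_one, zpow_sub, zpow_natCast, zpow_natCast,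
    inv_pow]

theorem sp_eq_kingSum {R : Type*} [CommRing R] {ℓ : ℕ} (z : Fin ℓ → Rˣ) (μ : YoungDiagram) :
    sp μ z = kingSum (fun a => ((letterWeight z a : Rˣ) : R)) (2 * ℓ) μ := by
  refine Fintype.sum_equiv (Equiv.refl _) _ _ fun T => ?_
  rw [weight_eq_prod_letterWeight z T, Units.coe_prod]
  rfl

/-! ### Horizontal strips and alternating maps -/

section

theorem mem_rect {L n : ℕ} {c : ℕ × ℕ} : c ∈ rect L n ↔ c.1 < L ∧ c.2 < n := by
  rw [← YoungDiagram.mem_cells]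
  simp [rect]

theorem le_rect_iff {μ : YoungDiagram} {L n : ℕ} :
    μ ≤ rect L n ↔ μ.colLen 0 ≤ L ∧ μ.rowLen 0 ≤ n := by
  constructor
  · intro h
    constructor
    · by_contra! hlt
      exact lt_irrefl _ (mem_rect.1 (h (YoungDiagram.mem_iff_lt_colLen.2 hlt))).1
    · by_contra! hlt
      exact lt_irrefl _ (mem_rect.1 (h (YoungDiagram.mem_iff_lt_rowLen.2 hlt))).2
  · rintro ⟨h1, h2⟩ ⟨i, j⟩ hc
    rw [← SetLike.mem_coe, SetLike.mem_coe]
    exact mem_rect.2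
      ⟨(YoungDiagram.mem_iff_lt_colLen.1 (μ.up_left_mem le_rfl (Nat.zero_le j) hc)).trans_le h1,
        (YoungDiagram.mem_iff_lt_rowLen.1 (μ.up_left_mem (Nat.zero_le i) le_rfl hc)).trans_le h2⟩

/-- The Young diagrams with at most `L` rows and at most `n` columns. -/
noncomputable def boxed (L n : ℕ) : Finset YoungDiagram :=
  univ.map (Function.Embedding.subtype fun μ => μ ≤ rect L n)

theorem mem_boxed {L n : ℕ} {μ : YoungDiagram} : μ ∈ boxed L n ↔ μ ≤ rect L n := by
  simp [boxed]

theorem mem_boxed_of_le {L n : ℕ} {μ ν : YoungDiagram} (h : μ ∈ boxed L n) (hν : ν ≤ μ) :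
    ν ∈ boxed L n :=
  mem_boxed.2 (hν.trans (mem_boxed.1 h))

/-- The lengths of the first `n` columns. -/
def cols (n : ℕ) (μ : YoungDiagram) (j : Fin n) : ℕ := μ.colLen j

theorem antitone_cols (n : ℕ) (μ : YoungDiagram) : Antitone (cols n μ) :=
  fun _ _ h => μ.colLen_anti _ _ h

theorem ext_cols {L n : ℕ} {μ ν : YoungDiagram} (hμ : μ ≤ rect L n) (hν : ν ≤ rect L n)
    (h : cols n μ = cols n ν) : μ = ν := by
  refine SetLike.ext fun ⟨i, j⟩ => ?_
  by_cases hj : j < n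
  · rw [YoungDiagram.mem_iff_lt_colLen, YoungDiagram.mem_iff_lt_colLen]
    exact iff_of_eq (congrArg (i < ·) (congrFun h ⟨j, hj⟩))
  · exact iff_of_false (fun hc => hj (mem_rect.1 (hμ hc)).2) fun hc => hj (mem_rect.1 (hν hc)).2

/-- The Young diagram with given column lengths. -/
def ofCols {n : ℕ} (f : Fin n → ℕ) (hf : Antitone f) : YoungDiagram where
  cells := univ.biUnion fun j : Fin n => range (f j) ×ˢ {(j : ℕ)}
  isLowerSet := by
    rintro ⟨i, j⟩ ⟨i', j'⟩ ⟨hi, hj⟩ h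
    have hi' : i' ≤ i := hi
    have hj' : j' ≤ j := hj
    simp only [coe_biUnion, coe_univ, Set.mem_univ, Set.iUnion_true, Set.mem_iUnion, mem_coe,
      mem_product, mem_range, mem_singleton] at h ⊢
    obtain ⟨a, h1, h2⟩ := h
    have ha := a.2
    have hle : f a ≤ f ⟨j', by omega⟩ := hf (Fin.mk_le_of_le_val (by omega))
    exact ⟨⟨j', by omega⟩, by omega, rfl⟩

theorem mem_ofCols {n : ℕ} {f : Fin n → ℕ} {hf : Antitone f} {i j : ℕ} :
    (i, j) ∈ ofCols f hf ↔ ∃ h : j < n, i < f ⟨j, h⟩ := by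
  rw [← YoungDiagram.mem_cells]
  simp only [ofCols, mem_biUnion, mem_univ, true_and, mem_product, mem_range, mem_singleton]
  constructor
  · rintro ⟨a, h1, rfl⟩
    exact ⟨a.2, h1⟩
  · rintro ⟨h, h1⟩
    exact ⟨⟨j, h⟩, h1, rfl⟩

theorem cols_ofCols {n : ℕ} (f : Fin n → ℕ) (hf : Antitone f) : cols n (ofCols f hf) = f := by
  funext j
  refine eq_of_forall_lt_iff fun i => ?_
  rw [cols, ← YoungDiagram.mem_iff_lt_colLen, mem_ofCols]
  exact ⟨fun h => h.2, fun h => ⟨j.2, h⟩⟩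

theorem ofCols_le_rect {n L : ℕ} {f : Fin n → ℕ} {hf : Antitone f} (h : ∀ j, f j ≤ L) :
    ofCols f hf ≤ rect L n := by
  rintro ⟨i, j⟩ hc
  obtain ⟨hj, hi⟩ := mem_ofCols.1 hc
  exact mem_rect.2 ⟨hi.trans_le (h _), hj⟩

theorem IsHorizontalStrip.colLen_le {ν μ : YoungDiagram} (h : IsHorizontalStrip ν μ) (j : ℕ) :
    ν.colLen j ≤ μ.colLen j ∧ μ.colLen j ≤ ν.colLen j + 1 := by
  constructor
  · by_contra! hlt
    exact lt_irrefl _ (YoungDiagram.mem_iff_lt_colLen.1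
      (h.1 (YoungDiagram.mem_iff_lt_colLen.2 hlt)))
  · by_contra! hlt
    exact lt_irrefl _ (YoungDiagram.mem_iff_lt_colLen.1
      (h.2 _ _ (YoungDiagram.mem_iff_lt_colLen.2 hlt)))

theorem isHorizontalStrip_of_cols {L n : ℕ} {ν μ : YoungDiagram} (hν : ν ≤ rect L n)
    (hμ : μ ≤ rect L n) (h : ∀ j, cols n ν j ≤ cols n μ j ∧ cols n μ j ≤ cols n ν j + 1) :
    IsHorizontalStrip ν μ := by
  constructor
  · rintro ⟨i, j⟩ hc
    have hj := (mem_rect.1 (hν hc)).2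
    exact YoungDiagram.mem_iff_lt_colLen.2
      ((YoungDiagram.mem_iff_lt_colLen.1 hc).trans_le (h ⟨j, hj⟩).1)
  · intro i j hc
    have hj := (mem_rect.1 (hμ hc)).2
    have h2 := (h ⟨j, hj⟩).2
    have h3 := YoungDiagram.mem_iff_lt_colLen.1 hc
    simp only [cols] at h2
    exact YoungDiagram.mem_iff_lt_colLen.2 (by omega)

/-- The column lengths after one cell has been added to each column in `s`. -/
def addCells {n : ℕ} (c : Fin n → ℕ) (s : Finset (Fin n)) (j : Fin n) : ℕ :=
  c j + if j ∈ s then 1 else 0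

theorem card_sdiff_of_cols_eq_addCells {L n : ℕ} {ν μ : YoungDiagram} (hμ : μ ≤ rect L n)
    {s : Finset (Fin n)} (h : cols n μ = addCells (cols n ν) s) : #(μ.cells \ ν.cells) = #s := by
  have himage : μ.cells \ ν.cells = s.image fun a => (cols n ν a, (a : ℕ)) := by
    ext ⟨i, j⟩
    rw [mem_sdiff, YoungDiagram.mem_cells, YoungDiagram.mem_cells, mem_image]
    constructor
    · rintro ⟨h1, h2⟩
      have hj := (mem_rect.1 (hμ h1)).2
      have h3 : μ.colLen j = _ := congrFun h ⟨j, hj⟩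
      rw [YoungDiagram.mem_iff_lt_colLen] at h1 h2
      simp only [addCells, cols] at h3
      refine ⟨⟨j, hj⟩, ?_, ?_⟩
      · by_contra hs
        rw [if_neg hs] at h3
        omega
      · split_ifs at h3
        · exact Prod.ext (by simp only [cols]; omega) rfl
        · omega
    · rintro ⟨a, ha, hij⟩
      have h3 : μ.colLen a = _ := congrFun h a
      rw [Prod.mk.injEq] at hij
      rw [YoungDiagram.mem_iff_lt_colLen, YoungDiagram.mem_iff_lt_colLen, ← hij.1, ← hij.2, h3,
        addCells, if_pos ha, cols]
      omega
  rw [himage, card_image_of_injective]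
  intro a b hab
  exact Fin.ext (Prod.ext_iff.1 hab).2

open Classical in
/-- A horizontal strip added to `ν` is determined by the set of the columns that it meets, and a
set of columns is possible if and only if the new column lengths are weakly decreasing. -/
theorem sum_isHorizontalStrip {R : Type*} [CommSemiring R] {L n : ℕ} {ν : YoungDiagram}
    (hν : ν ≤ rect L n) (hL : ν.colLen 0 < L) (w : R) (F : (Fin n → ℕ) → R) :
    (∑ s : Finset (Fin n),
      if Antitone (addCells (cols n ν) s) then w ^ #s * F (addCells (cols n ν) s) else 0) =
    ∑ μ ∈ boxed L n,
      if IsHorizontalStrip ν μ then w ^ #(μ.cells \ ν.cells) * F (cols n μ) else 0 := by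
  rw [← sum_filter, ← sum_filter]
  have hle : ∀ s (hs : Antitone (addCells (cols n ν) s)), ofCols _ hs ≤ rect L n := by
    intro s hs
    refine ofCols_le_rect fun j => ?_
    have := ν.colLen_anti 0 j (Nat.zero_le _)
    simp only [addCells, cols]
    split_ifs <;> omega
  have hcols : ∀ μ, IsHorizontalStrip ν μ →
      addCells (cols n ν) (univ.filter fun j => cols n μ j = cols n ν j + 1) = cols n μ := by
    intro μ h
    funext j
    have := h.colLen_le j
    have hmem : (j ∈ univ.filter fun j => cols n μ j = cols n ν j + 1) ↔
        cols n μ j = cols n ν j + 1 := by simp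
    rw [addCells]
    by_cases hj : cols n μ j = cols n ν j + 1
    · rw [if_pos (hmem.2 hj), hj]
    · rw [if_neg (mt hmem.1 hj)]
      simp only [cols] at hj ⊢
      omega
  refine sum_bij' (fun s hs => ofCols _ (mem_filter.1 hs).2)
    (fun μ _ => univ.filter fun j => cols n μ j = cols n ν j + 1) ?_ ?_ ?_ ?_ ?_
  · intro s hs
    refine mem_filter.2 ⟨mem_boxed.2 (hle _ _), isHorizontalStrip_of_cols hν (hle _ _) fun j => ?_⟩
    rw [cols_ofCols, addCells]
    split_ifs <;> omega
  · intro μ hμ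
    have h := (mem_filter.1 hμ).2
    refine mem_filter.2 ⟨mem_univ _, ?_⟩
    rw [hcols μ h]
    exact antitone_cols n μ
  · intro s hs
    ext j
    rw [cols_ofCols]
    simp [addCells]
  · intro μ hμ
    have h := (mem_filter.1 hμ).2
    refine ext_cols (hle _ _) (mem_boxed.1 (mem_filter.1 hμ).1) ?_
    rw [cols_ofCols, hcols μ h]
  · intro s hs
    rw [cols_ofCols, card_sdiff_of_cols_eq_addCells (hle _ _) (cols_ofCols _ _)]

/-- If adding a cell to each column in `s` destroys monotonicity, then two consecutive columns
become indistinguishable for the strictly decreasing labels `c j - j`. -/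
theorem exists_eq_of_not_antitone_addCells {n : ℕ} {c : Fin n → ℕ} (hc : Antitone c)
    {s : Finset (Fin n)} (h : ¬ Antitone (addCells c s)) :
    ∃ i j, i ≠ j ∧ (addCells c s i : ℤ) - (i : ℕ) = (addCells c s j : ℤ) - (j : ℕ) := by
  cases n with
  | zero => exact absurd (fun i => i.elim0) h
  | succ n =>
    rw [Fin.antitone_iff_succ_le] at h
    push Not at h
    obtain ⟨i, hi⟩ := h
    refine ⟨i.castSucc, i.succ, (Fin.castSucc_lt_succ).ne, ?_⟩
    have := hc (Fin.castSucc_lt_succ (i := i)).le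
    simp only [addCells] at hi ⊢
    simp only [Fin.val_castSucc, Fin.val_succ]
    split_ifs at hi ⊢ <;> push_cast <;> omega

variable {R M : Type*} [CommRing R] [AddCommGroup M] [Module R M]

open Classical in
/-- Adding a horizontal strip to `ν` in all possible ways amounts to the action of `1 + w • shift`
on each argument of an alternating map. -/
theorem map_add_smul_shift {L n : ℕ} (ω : M [⋀^Fin n]→ₗ[R] R) (h : ℤ → M) (w : R)
    {ν : YoungDiagram} (hν : ν ≤ rect L n) (hL : ν.colLen 0 < L) :
    (ω fun j => h (cols n ν j - (j : ℕ)) + w • h (cols n ν j + 1 - (j : ℕ))) =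
      ∑ μ ∈ boxed L n, if IsHorizontalStrip ν μ then
        w ^ #(μ.cells \ ν.cells) * ω fun j => h (cols n μ j - (j : ℕ)) else 0 := by
  rw [← sum_isHorizontalStrip hν hL w fun c => ω fun j => h (c j - (j : ℕ))]
  have hsplit : (fun j : Fin n => h (cols n ν j - (j : ℕ)) + w • h (cols n ν j + 1 - (j : ℕ))) =
      (fun j : Fin n => w • h (cols n ν j + 1 - (j : ℕ))) + fun j => h (cols n ν j - (j : ℕ)) :=
    funext fun j => add_comm _ _
  rw [hsplit, AlternatingMap.map_add_univ]
  refine sum_congr rfl fun s _ => ?_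
  have hpw : s.piecewise (fun j : Fin n => w • h (cols n ν j + 1 - (j : ℕ)))
      (fun j => h (cols n ν j - (j : ℕ))) =
      fun j => (if j ∈ s then w else 1) • h (addCells (cols n ν) s j - (j : ℕ)) := by
    funext j
    simp only [Finset.piecewise, addCells]
    split_ifs <;> simp
  rw [hpw, AlternatingMap.map_smul_univ, prod_ite_mem, univ_inter, prod_const, smul_eq_mul]
  split_ifs with ha
  · rfl
  · obtain ⟨i, j, hij, heq⟩ := exists_eq_of_not_antitone_addCells (antitone_cols n ν) ha
    rw [ω.map_eq_zero_of_eq _ (congrArg h heq) hij, mul_zero]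

/-- Adding the letter with code `k` to all King tableaux in the letters below `k`. The vanishing
of `h` discards the shapes with one row too many for the King condition. -/
theorem sum_kingSum_succ {L n k : ℕ} (hk : k + 1 ≤ L) (ω : M [⋀^Fin n]→ₗ[R] R) (h : ℤ → M)
    (w : ℕ → R) (hh : ∀ i : ℕ, k = 2 * i + 1 → h (i + 2) = 0) :
    (∑ ν ∈ boxed L n, kingSum w k ν *
      ω fun j => h (cols n ν j - (j : ℕ)) + w k • h (cols n ν j + 1 - (j : ℕ))) =
    ∑ μ ∈ boxed L n, kingSum w (k + 1) μ * ω fun j => h (cols n μ j - (j : ℕ)) := by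
  classical
  have hexpand : ∀ ν ∈ boxed L n, (kingSum w k ν *
      ω fun j => h (cols n ν j - (j : ℕ)) + w k • h (cols n ν j + 1 - (j : ℕ))) =
      ∑ μ ∈ boxed L n, (if IsHorizontalStrip ν μ then
        w k ^ #(μ.cells \ ν.cells) * kingSum w k ν else 0) *
          ω fun j => h (cols n μ j - (j : ℕ)) := by
    intro ν hν
    by_cases hrow : k + 1 < 2 * ν.colLen 0
    · simp [kingSum_eq_zero w hrow]
    · rw [map_add_smul_shift ω h (w k) (mem_boxed.1 hν) (by omega), mul_sum]
      refine sum_congr rfl fun μ _ => ?_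
      split_ifs <;> ring
  rw [sum_congr rfl hexpand, sum_comm]
  refine sum_congr rfl fun μ hμ => ?_
  rw [← sum_mul]
  by_cases hr : 2 * μ.colLen 0 ≤ k + 2
  · rw [kingSum_succ w hr fun ν hν => mem_boxed_of_le hμ hν]
  · rw [kingSum_eq_zero w (by omega), zero_mul]
    by_cases hi : ∃ i, k = 2 * i + 1 ∧ μ.colLen 0 = i + 2
    · obtain ⟨i, hki, hcol⟩ := hi
      have hn : 0 < n := by
        have hc : (0, 0) ∈ μ := YoungDiagram.mem_iff_lt_colLen.2 (by omega)
        exact (mem_rect.1 (mem_boxed.1 hμ hc)).2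
      have hz : h (cols n μ ⟨0, hn⟩ - ((⟨0, hn⟩ : Fin n) : ℕ)) = 0 := by
        simp only [cols, hcol]
        push_cast
        rw [sub_zero, hh i hki]
      rw [ω.map_coord_zero ⟨0, hn⟩ hz, mul_zero]
    · rw [sum_eq_zero, zero_mul]
      intro ν _
      split_ifs with hs
      · have h1 := hs.colLen_le 0
        rw [kingSum_eq_zero w, mul_zero]
        by_contra hlt
        exact hi ⟨(k - 1) / 2, by omega, by omega⟩
      · rfl

end

/-! ### Multiplication by a product of linear factors -/

theorem colLen_bot (j : ℕ) : (⊥ : YoungDiagram).colLen j = 0 :=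
  Nat.eq_zero_of_not_pos fun h =>
    YoungDiagram.notMem_bot _ (YoungDiagram.mem_iff_lt_colLen.2 h)

theorem eq_bot_of_colLen_zero {μ : YoungDiagram} (h : μ.colLen 0 = 0) : μ = ⊥ := by
  refine eq_bot_iff.2 fun ⟨i, j⟩ hc => ?_
  have := YoungDiagram.mem_iff_lt_colLen.1 (μ.up_left_mem le_rfl (Nat.zero_le j) hc)
  omega

/-- The exponents attached to the columns of a diagram with at most `i` rows: strictly increasing
numbers in `{0, …, n + i - 1}`. -/
def colExponent (n i : ℕ) (μ : YoungDiagram) (j : Fin n) : ℤ := i - (cols n μ j - (j : ℕ))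

/-- The action of `∏ a, (t + w (2 a) + w (2 a + 1))` on `e 0 ∧ ⋯ ∧ e (n - 1)`, for `e` subject to
the recurrence of the Chebyshev polynomials: the coefficients are the generating functions of King
tableaux. Each factor is the composite
`e c ↦ (w (2 a) + shift) (1 + w (2 a + 1) shift⁻¹) e c`, whose two constituents add the letters
with codes `2 a` and `2 a + 1`. -/
theorem map_prod_mul_eq_sum_kingSum {R A : Type*} [CommRing R] [CommRing A] [Algebra R A]
    {n L i : ℕ} (hi : 2 * i ≤ L) {t : A} {e : ℤ → A} (he : e (-1) = 0)
    (hte : ∀ c, 0 ≤ c → t * e c = e (c + 1) + e (c - 1)) {w : ℕ → R}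
    (hw : ∀ a, w (2 * a) * w (2 * a + 1) = 1) (ω : A [⋀^Fin n]→ₗ[R] R) :
    (ω fun j => (∏ a ∈ range i, (t + algebraMap R A (w (2 * a) + w (2 * a + 1)))) *
      e (j : ℕ)) =
    ∑ μ ∈ boxed L n, kingSum w (2 * i) μ * ω fun j => e (colExponent n i μ j) := by
  induction i generalizing ω with
  | zero =>
    rw [sum_eq_single ⊥]
    · simp [kingSum_zero_bot, colExponent, cols, colLen_bot]
    · intro μ _ hμ
      rw [kingSum_eq_zero, zero_mul]
      have : μ.colLen 0 ≠ 0 := fun h => hμ (eq_bot_of_colLen_zero h)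
      omega
    · exact fun h => absurd (mem_boxed.2 bot_le) h
  | succ i ih =>
    set s : R := w (2 * i) + w (2 * i + 1) with hs
    have h0 := ih (by omega) (ω.compLinearMap (LinearMap.mulLeft R (t + algebraMap R A s)))
    simp only [AlternatingMap.compLinearMap_apply, LinearMap.mulLeft_apply] at h0
    have hstart : (fun j : Fin n =>
        (∏ a ∈ range (i + 1), (t + algebraMap R A (w (2 * a) + w (2 * a + 1)))) * e (j : ℕ)) =
        fun j : Fin n => (t + algebraMap R A s) *
          ((∏ a ∈ range i, (t + algebraMap R A (w (2 * a) + w (2 * a + 1)))) * e (j : ℕ)) := by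
      funext j
      rw [prod_range_succ, ← hs]
      ring
    rw [hstart, h0]
    -- `f` is `e` and `g` is `(1 + w (2 i + 1) shift⁻¹) e`, both indexed by `i + 1 - c`.
    set f : ℤ → A := fun d => e (i + 1 - d) with hf
    set g : ℤ → A := fun d => f d + w (2 * i + 1) • f (d + 1) with hg
    have hfactor : ∀ d : ℤ, d ≤ i →
        (t + algebraMap R A s) * e (i - d) = g d + w (2 * i) • g (d + 1) := by
      intro d hd
      have h1 := hte (i - d) (by omega)
      have h2 : algebraMap R A (w (2 * i)) * algebraMap R A (w (2 * i + 1)) = 1 := by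
        rw [← map_mul, hw, map_one]
      simp only [hg, hf, hs, Algebra.smul_def, map_add]
      rw [show (i : ℤ) + 1 - (d + 1) = i - d by ring, show (i : ℤ) + 1 - d = i - d + 1 by ring,
        show (i : ℤ) + 1 - (d + 1 + 1) = i - d - 1 by ring]
      linear_combination h1 - e (i - d - 1) * h2
    have hfirst : ∀ ν ∈ boxed L n, (kingSum w (2 * i) ν *
        ω fun j => (t + algebraMap R A s) * e (colExponent n i ν j)) =
        kingSum w (2 * i) ν *
          ω fun j => g (cols n ν j - (j : ℕ)) + w (2 * i) • g (cols n ν j + 1 - (j : ℕ)) := by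
      intro ν _
      by_cases hrow : 2 * i + 1 < 2 * ν.colLen 0
      · rw [kingSum_eq_zero w hrow, zero_mul, zero_mul]
      · congr 2
        funext j
        have := ν.colLen_anti 0 j (Nat.zero_le _)
        rw [colExponent, hfactor _ (by simp only [cols]; omega),
          show (cols n ν j : ℤ) - (j : ℕ) + 1 = cols n ν j + 1 - (j : ℕ) by ring]
    rw [sum_congr rfl hfirst, sum_kingSum_succ (by omega) ω g w (by omega)]
    have hsecond : ∀ ν : YoungDiagram, (fun j : Fin n => g (cols n ν j - (j : ℕ))) =
        fun j : Fin n => f (cols n ν j - (j : ℕ)) +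
          w (2 * i + 1) • f (cols n ν j + 1 - (j : ℕ)) := by
      intro ν
      funext j
      simp only [hg]
      rw [show (cols n ν j : ℤ) - (j : ℕ) + 1 = cols n ν j + 1 - (j : ℕ) by ring]
    simp only [hsecond]
    rw [sum_kingSum_succ (by omega) ω f w]
    · refine sum_congr rfl fun μ _ => ?_
      simp only [hf, colExponent]
      push_cast
      rfl
    · intro a ha
      obtain rfl : a = i := by omega
      simp only [hf]
      rw [show (a : ℤ) + 1 - (a + 2) = -1 by ring, he]

/-! ### The resultant in the basis of Chebyshev polynomials -/

/-- The shapes with more than `i` rows carry no King tableaux, so the auxiliary bound `L` on the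
number of rows can be replaced by `i`. -/
theorem map_prod_mul_eq_sum_boxed {R A : Type*} [CommRing R] [CommRing A] [Algebra R A]
    {n i : ℕ} {t : A} {e : ℤ → A} (he : e (-1) = 0)
    (hte : ∀ c, 0 ≤ c → t * e c = e (c + 1) + e (c - 1)) {w : ℕ → R}
    (hw : ∀ a, w (2 * a) * w (2 * a + 1) = 1) (ω : A [⋀^Fin n]→ₗ[R] R) :
    (ω fun j => (∏ a ∈ range i, (t + algebraMap R A (w (2 * a) + w (2 * a + 1)))) *
      e (j : ℕ)) =
    ∑ μ ∈ boxed i n, kingSum w (2 * i) μ * ω fun j => e (colExponent n i μ j) := by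
  rw [map_prod_mul_eq_sum_kingSum le_rfl he hte hw ω]
  refine (sum_subset (fun μ hμ => ?_) fun μ hμ hn => ?_).symm
  · have := le_rect_iff.1 (mem_boxed.1 hμ)
    exact mem_boxed.2 (le_rect_iff.2 ⟨by omega, this.2⟩)
  · rw [kingSum_eq_zero w, zero_mul]
    by_contra hlt
    exact hn (mem_boxed.2 (le_rect_iff.2 ⟨by omega, (le_rect_iff.1 (mem_boxed.1 hμ)).2⟩))

section Alternating

variable {R M N ι κ : Type*} [CommSemiring R] [AddCommMonoid M] [Module R M] [AddCommMonoid N]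
  [Module R N]

/-- An alternating map in two blocks of arguments, with the second block fixed. -/
def fixRight (D : M [⋀^ι ⊕ κ]→ₗ[R] N) (u : κ → M) : M [⋀^ι]→ₗ[R] N where
  toFun v := D (Sum.elim v u)
  map_update_add' v i x y := by
    classical
    simp only [← Sum.update_elim_inl, AlternatingMap.map_update_add]
  map_update_smul' v i c x := by
    classical
    simp only [← Sum.update_elim_inl, AlternatingMap.map_update_smul]
  map_eq_zero_of_eq' v i j h hij :=
    D.map_eq_zero_of_eq (i := Sum.inl i) (j := Sum.inl j) _ h (Sum.inl_injective.ne hij)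

/-- An alternating map in two blocks of arguments, with the first block fixed. -/
def fixLeft (D : M [⋀^ι ⊕ κ]→ₗ[R] N) (u : ι → M) : M [⋀^κ]→ₗ[R] N where
  toFun v := D (Sum.elim u v)
  map_update_add' v i x y := by
    classical
    simp only [← Sum.update_elim_inr, AlternatingMap.map_update_add]
  map_update_smul' v i c x := by
    classical
    simp only [← Sum.update_elim_inr, AlternatingMap.map_update_smul]
  map_eq_zero_of_eq' v i j h hij :=
    D.map_eq_zero_of_eq (i := Sum.inr i) (j := Sum.inr j) _ h (Sum.inr_injective.ne hij)

end Alternating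

theorem fixRight_apply {R M N ι κ : Type*} [CommSemiring R] [AddCommMonoid M] [Module R M]
    [AddCommMonoid N] [Module R N] (D : M [⋀^ι ⊕ κ]→ₗ[R] N) (u : κ → M) (v : ι → M) :
    fixRight D u v = D (Sum.elim v u) := rfl

theorem fixLeft_apply {R M N ι κ : Type*} [CommSemiring R] [AddCommMonoid M] [Module R M]
    [AddCommMonoid N] [Module R N] (D : M [⋀^ι ⊕ κ]→ₗ[R] N) (u : ι → M) (v : κ → M) :
    fixLeft D u v = D (Sum.elim u v) := rfl

open Polynomial
open Polynomial.Chebyshev (S)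

theorem natDegree_S_and_monic (R : Type*) [CommRing R] [Nontrivial R] (k : ℕ) :
    (S R k).natDegree = k ∧ (S R k).Monic := by
  induction k using Nat.twoStepInduction with
  | zero => simp
  | one => simp [monic_X]
  | more k ih1 ih2 =>
    have hrec : S R ((k + 2 : ℕ) : ℤ) = X * S R ((k + 1 : ℕ) : ℤ) - S R (k : ℤ) := by
      push_cast
      exact Chebyshev.S_add_two R k
    have hd : (X * S R ((k + 1 : ℕ) : ℤ)).natDegree = k + 2 := by
      rw [natDegree_X_mul ih2.2.ne_zero, ih2.1]
    have hm : (X * S R ((k + 1 : ℕ) : ℤ)).Monic := monic_X.mul ih2.2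
    have hlt : (S R (k : ℤ)).natDegree < (X * S R ((k + 1 : ℕ) : ℤ)).natDegree := by
      rw [hd, ih1.1]
      omega
    rw [hrec]
    exact ⟨by rw [natDegree_sub_eq_left_of_natDegree_lt hlt, hd],
      hm.sub_of_left (degree_lt_degree hlt)⟩

/-- The determinant of `n + ℓ` polynomials of degree less than `n + ℓ` with respect to the
basis of monomials; the polynomials come in two blocks. -/
noncomputable def coeffDet (R : Type*) [CommRing R] (n ℓ : ℕ) :
    R[X] [⋀^Fin n ⊕ Fin ℓ]→ₗ[R] R :=
  Matrix.detRowAlternating.compLinearMap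
    (LinearMap.pi fun a : Fin n ⊕ Fin ℓ => lcoeff R (finSumFinEquiv a : ℕ))

variable {R : Type*} [CommRing R]

theorem coeffDet_apply {n ℓ : ℕ} (v : Fin n ⊕ Fin ℓ → R[X]) :
    coeffDet R n ℓ v =
      (Matrix.of fun b a : Fin n ⊕ Fin ℓ => (v b).coeff (finSumFinEquiv a : ℕ)).det := rfl

theorem det_coeff_S [Nontrivial R] (m : ℕ) :
    (Matrix.of fun b a : Fin m => (S R (b : ℕ)).coeff a).det = 1 := by
  rw [← Matrix.det_transpose]
  exact Matrix.det_matrixOfPolynomials (fun b : Fin m => S R (b : ℕ))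
    (fun b => (natDegree_S_and_monic R b).1) fun b => (natDegree_S_and_monic R b).2

theorem coeffDet_mul_X_pow {n ℓ : ℕ} {p q : R[X]} (hp : p.natDegree ≤ ℓ) (hq : q.natDegree ≤ n) :
    coeffDet R n ℓ (Sum.elim (fun j => p * X ^ (j : ℕ)) fun i => q * X ^ (i : ℕ)) =
      resultant q p n ℓ := by
  rw [coeffDet_apply, resultant, ← Matrix.det_transpose,
    ← Matrix.det_submatrix_equiv_self finSumFinEquiv (sylvester q p n ℓ)]
  congr 1
  ext a (j | i)
  · simp only [Matrix.transpose_apply, Matrix.of_apply, Sum.elim_inl, Matrix.submatrix_apply,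
      sylvester, finSumFinEquiv_apply_left, Fin.addCases_left, coeff_mul_X_pow', Set.mem_Icc]
    by_cases h1 : (j : ℕ) ≤ finSumFinEquiv a
    · by_cases h2 : (finSumFinEquiv a : ℕ) ≤ j + ℓ
      · rw [if_pos h1, if_pos ⟨h1, h2⟩]
      · rw [if_pos h1, if_neg fun h => h2 h.2]
        exact coeff_eq_zero_of_natDegree_lt (by omega)
    · rw [if_neg h1, if_neg fun h => h1 h.1]
  · simp only [Matrix.transpose_apply, Matrix.of_apply, Sum.elim_inr, Matrix.submatrix_apply,
      sylvester, finSumFinEquiv_apply_right, Fin.addCases_right, coeff_mul_X_pow', Set.mem_Icc]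
    by_cases h1 : (i : ℕ) ≤ finSumFinEquiv a
    · by_cases h2 : (finSumFinEquiv a : ℕ) ≤ i + n
      · rw [if_pos h1, if_pos ⟨h1, h2⟩]
      · rw [if_pos h1, if_neg fun h => h2 h.2]
        exact coeff_eq_zero_of_natDegree_lt (by omega)
    · rw [if_neg h1, if_neg fun h => h1 h.1]

theorem mul_S_coeff [Nontrivial R] {m : ℕ} (p : R[X]) (j : Fin m) (a : ℕ) :
    (p * S R (j : ℕ)).coeff a = ∑ k : Fin m, (S R (j : ℕ)).coeff k * (p * X ^ (k : ℕ)).coeff a := by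
  have hdeg : (S R ((j : ℕ) : ℤ)).natDegree < m := by
    rw [(natDegree_S_and_monic R j).1]
    exact j.2
  conv_lhs => rw [(S R ((j : ℕ) : ℤ)).as_sum_range_C_mul_X_pow' hdeg]
  rw [mul_sum, finsetSum_coeff, sum_range]
  refine sum_congr rfl fun k _ => ?_
  rw [mul_left_comm, coeff_C_mul]

/-- The resultant can be computed in the basis of the Chebyshev polynomials, since the base change
is unitriangular. -/
theorem coeffDet_mul_S [Nontrivial R] {n ℓ : ℕ} {p q : R[X]} (hp : p.natDegree ≤ ℓ)
    (hq : q.natDegree ≤ n) :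
    coeffDet R n ℓ (Sum.elim (fun j => p * S R (j : ℕ)) fun i => q * S R (i : ℕ)) =
      resultant q p n ℓ := by
  rw [← coeffDet_mul_X_pow hp hq, coeffDet_apply, coeffDet_apply]
  have hfactor : (Matrix.of fun b a : Fin n ⊕ Fin ℓ =>
      ((Sum.elim (fun j : Fin n => p * S R (j : ℕ)) fun i : Fin ℓ => q * S R (i : ℕ)) b).coeff
        (finSumFinEquiv a : ℕ)) =
      Matrix.fromBlocks (Matrix.of fun b a : Fin n => (S R (b : ℕ)).coeff a) 0 0
        (Matrix.of fun b a : Fin ℓ => (S R (b : ℕ)).coeff a) *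
      Matrix.of fun b a : Fin n ⊕ Fin ℓ =>
        ((Sum.elim (fun j : Fin n => p * X ^ (j : ℕ)) fun i : Fin ℓ => q * X ^ (i : ℕ)) b).coeff
          (finSumFinEquiv a : ℕ) := by
    ext (j | i) a
    · simp [Matrix.mul_apply, mul_S_coeff]
    · simp [Matrix.mul_apply, mul_S_coeff]
  rw [hfactor, Matrix.det_mul, Matrix.det_fromBlocks_zero₂₁, det_coeff_S, det_coeff_S, one_mul,
    one_mul]

theorem resultant_prod_eq [Nontrivial R] {n ℓ : ℕ} (a : Fin n → R) (b : Fin ℓ → R) :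
    resultant (∏ i, (X - C (a i))) (∏ j, (X + C (b j))) n ℓ = ∏ i, ∏ j, (a i + b j) := by
  have hp : (∏ j, (X + C (b j))).natDegree ≤ ℓ := by
    refine (natDegree_prod_le _ _).trans ?_
    simp
  have hq : (∏ i, (X - C (a i))).natDegree = n := by
    rw [natDegree_prod_of_monic _ _ fun i _ => monic_X_sub_C _]
    simp
  have h := resultant_prod_left univ (fun i => X - C (a i)) (∏ j, (X + C (b j))) ℓ (by simp) hp
  rw [hq] at h
  rw [h]
  refine prod_congr rfl fun i _ => ?_
  rw [natDegree_X_sub_C, resultant_X_sub_C_left _ _ _ hp, eval_prod]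
  simp

/-! ### Complementary sets of exponents -/

/-- The sign of a shuffle is the parity of its number of inversions; these involve one element of
each block. -/
theorem sign_of_strictMono_blocks {n ℓ : ℕ} (σ : Equiv.Perm (Fin n ⊕ Fin ℓ))
    (hl : StrictMono fun j => finSumFinEquiv (σ (Sum.inl j)))
    (hr : StrictMono fun i => finSumFinEquiv (σ (Sum.inr i))) :
    Equiv.Perm.sign σ = ∏ i : Fin ℓ,
      (-1) ^ #{j : Fin n | finSumFinEquiv (σ (Sum.inr i)) < finSumFinEquiv (σ (Sum.inl j))} := by
  rw [← Equiv.Perm.sign_permCongr finSumFinEquiv σ, Equiv.Perm.sign_eq_prod_prod_Iio]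
  have hite : ∀ b : Fin (n + ℓ), ∀ f : Fin (n + ℓ) → ℤˣ,
      ∏ a ∈ Iio b, f a = ∏ a, if a < b then f a else 1 := by
    intro b f
    rw [← prod_filter]
    congr 1
    ext a
    simp
  simp only [hite, Fin.prod_univ_add, Equiv.permCongr_apply, finSumFinEquiv_symm_apply_castAdd,
    finSumFinEquiv_symm_apply_natAdd]
  have h1 : ∀ b a : Fin n, (if Fin.castAdd ℓ a < Fin.castAdd ℓ b then
      (if finSumFinEquiv (σ (Sum.inl a)) < finSumFinEquiv (σ (Sum.inl b)) then 1 else -1)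
      else 1 : ℤˣ) = 1 := by
    intro b a
    split_ifs with h h'
    · rfl
    · exact absurd (hl (show a < b from h)) h'
    · rfl
  have h2 : ∀ b a : Fin ℓ, (if Fin.natAdd n a < Fin.natAdd n b then
      (if finSumFinEquiv (σ (Sum.inr a)) < finSumFinEquiv (σ (Sum.inr b)) then 1 else -1)
      else 1 : ℤˣ) = 1 := by
    intro b a
    split_ifs with h h'
    · rfl
    · exact absurd (hr (show a < b by simpa using h)) h'
    · rfl
  have h3 : ∀ (b : Fin n) (a : Fin ℓ), ¬ Fin.natAdd n a < Fin.castAdd ℓ b := by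
    intro b a h
    rw [Fin.lt_def, Fin.val_natAdd, Fin.val_castAdd] at h
    omega
  have h4 : ∀ (b : Fin ℓ) (a : Fin n), Fin.castAdd ℓ a < Fin.natAdd n b := by
    intro b a
    rw [Fin.lt_def, Fin.val_natAdd, Fin.val_castAdd]
    omega
  simp only [h1, h2, h3, h4, if_true, if_false, prod_const_one, one_mul, mul_one]
  refine prod_congr rfl fun i _ => ?_
  rw [← prod_const, prod_filter]
  refine prod_congr rfl fun j _ => ?_
  have hne : finSumFinEquiv (σ (Sum.inl j)) ≠ finSumFinEquiv (σ (Sum.inr i)) := by simp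
  by_cases hlt : finSumFinEquiv (σ (Sum.inl j)) < finSumFinEquiv (σ (Sum.inr i))
  · rw [if_pos hlt, if_neg hlt.not_gt]
  · rw [if_neg hlt, if_pos (lt_of_le_of_ne (not_lt.1 hlt) hne.symm)]

theorem coeffDet_S_perm {R : Type*} [CommRing R] [Nontrivial R] {n ℓ : ℕ}
    (σ : Equiv.Perm (Fin n ⊕ Fin ℓ)) :
    coeffDet R n ℓ (fun b => S R ((finSumFinEquiv (σ b) : Fin (n + ℓ)) : ℕ)) =
      ((Equiv.Perm.sign σ : ℤ) : R) := by
  have h := (coeffDet R n ℓ).map_perm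
    (fun b => S R ((finSumFinEquiv b : Fin (n + ℓ)) : ℕ)) σ
  have h1 : coeffDet R n ℓ (fun b => S R ((finSumFinEquiv b : Fin (n + ℓ)) : ℕ)) = 1 := by
    rw [coeffDet_apply, ← det_coeff_S (R := R) (n + ℓ),
      ← Matrix.det_submatrix_equiv_self finSumFinEquiv
        (Matrix.of fun b a : Fin (n + ℓ) => (S R (b : ℕ)).coeff a)]
    rfl
  rw [h1] at h
  refine Eq.trans h ?_
  rw [Units.smul_def, zsmul_eq_mul, mul_one]

/-- The column exponents as natural numbers. -/
def colIndex (n i : ℕ) (μ : YoungDiagram) (j : Fin n) : ℕ := i + j - cols n μ j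

theorem cols_le {n i : ℕ} {μ : YoungDiagram} (hμ : μ ≤ rect i n) (j : Fin n) : cols n μ j ≤ i :=
  (μ.colLen_anti 0 j (Nat.zero_le _)).trans (le_rect_iff.1 hμ).1

theorem colExponent_eq {n i : ℕ} {μ : YoungDiagram} (hμ : μ ≤ rect i n) (j : Fin n) :
    colExponent n i μ j = (colIndex n i μ j : ℕ) := by
  have := cols_le hμ j
  rw [colExponent, colIndex]
  omega

theorem strictMono_colIndex {n i : ℕ} {μ : YoungDiagram} (hμ : μ ≤ rect i n) :
    StrictMono (colIndex n i μ) := by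
  intro a b hab
  have h1 := cols_le hμ a
  have h2 := antitone_cols n μ hab.le
  have h3 : (a : ℕ) < b := hab
  simp only [colIndex]
  omega

theorem colIndex_lt {n i : ℕ} (μ : YoungDiagram) (j : Fin n) :
    colIndex n i μ j < n + i := by
  have := j.2
  simp only [colIndex]
  omega

theorem rho_le_rect (n : ℕ) (μ : YoungDiagram) (ℓ : ℕ) : rho n μ ℓ ≤ rect n ℓ := by
  rintro ⟨i, j⟩ hc
  have h := (YoungDiagram.mem_cells _).2 (YoungDiagram.mem_transpose.1 hc)
  simp only [rectComplement, mem_filter, mem_product, mem_range, Prod.swap] at h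
  exact mem_rect.2 ⟨h.1.2, h.1.1⟩

theorem cols_rho (n : ℕ) (μ : YoungDiagram) (ℓ : ℕ) (i : Fin ℓ) :
    cols ℓ (rho n μ ℓ) i = n - μ.rowLen (ℓ - 1 - i) := by
  rw [cols, rho, YoungDiagram.colLen_transpose, rectComplement_rowLen μ i.2]

theorem rowLen_le {n ℓ : ℕ} {μ : YoungDiagram} (hμ : μ ≤ rect ℓ n) (i : ℕ) : μ.rowLen i ≤ n :=
  (μ.rowLen_anti 0 i (Nat.zero_le _)).trans (le_rect_iff.1 hμ).2

/-- The `j`-th column of `μ` and the `i`-th row from below: whether the cell where they meet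
belongs to `μ` decides which of the two exponents is larger. -/
theorem colIndex_lt_colIndex_rho {n ℓ : ℕ} {μ : YoungDiagram} (hμ : μ ≤ rect ℓ n) (j : Fin n)
    (i : Fin ℓ) (h : (j : ℕ) < μ.rowLen (ℓ - 1 - i)) :
    colIndex n ℓ μ j < colIndex ℓ n (rho n μ ℓ) i := by
  have h1 := YoungDiagram.mem_iff_lt_colLen.1 (YoungDiagram.mem_iff_lt_rowLen.2 h)
  have h2 := rowLen_le hμ (ℓ - 1 - i)
  have h3 := cols_le hμ j
  have h4 := i.2
  simp only [colIndex, cols_rho]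
  simp only [cols] at h3 ⊢
  omega

theorem colIndex_rho_lt_colIndex {n ℓ : ℕ} {μ : YoungDiagram} (hμ : μ ≤ rect ℓ n) (j : Fin n)
    (i : Fin ℓ) (h : ¬ (j : ℕ) < μ.rowLen (ℓ - 1 - i)) :
    colIndex ℓ n (rho n μ ℓ) i < colIndex n ℓ μ j := by
  have h1 : ¬ ℓ - 1 - i < μ.colLen j := fun h1 =>
    h (YoungDiagram.mem_iff_lt_rowLen.1 (YoungDiagram.mem_iff_lt_colLen.2 h1))
  have h2 := rowLen_le hμ (ℓ - 1 - i)
  have h4 := i.2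
  rw [colIndex, colIndex, cols_rho, cols]
  omega

/-- The two families of exponents in one map. -/
def pairIndex (n ℓ : ℕ) (μ ρ : YoungDiagram) : Fin n ⊕ Fin ℓ → Fin (n + ℓ) :=
  Sum.elim (fun j => ⟨colIndex n ℓ μ j, colIndex_lt μ j⟩)
    fun i => ⟨colIndex ℓ n ρ i, (colIndex_lt ρ i).trans_eq (add_comm _ _)⟩

theorem injective_pairIndex_iff {n ℓ : ℕ} {μ ρ : YoungDiagram} (hμ : μ ≤ rect ℓ n)
    (hρ : ρ ≤ rect n ℓ) : Function.Injective (pairIndex n ℓ μ ρ) ↔ ρ = rho n μ ℓ := by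
  have hinj : ∀ ρ, ρ ≤ rect n ℓ → (∀ j i, colIndex n ℓ μ j ≠ colIndex ℓ n ρ i) →
      Function.Injective (pairIndex n ℓ μ ρ) := by
    intro ρ hρ hne
    refine Function.Injective.sumElim (fun a b h => ?_) (fun a b h => ?_) fun a b h => ?_
    · exact (strictMono_colIndex hμ).injective (congrArg Fin.val h)
    · exact (strictMono_colIndex hρ).injective (congrArg Fin.val h)
    · exact hne a b (congrArg Fin.val h)
  have hrho : Function.Injective (pairIndex n ℓ μ (rho n μ ℓ)) := by
    refine hinj _ (rho_le_rect n μ ℓ) fun j i => ?_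
    by_cases h : (j : ℕ) < μ.rowLen (ℓ - 1 - i)
    · exact (colIndex_lt_colIndex_rho hμ j i h).ne
    · exact (colIndex_rho_lt_colIndex hμ j i h).ne'
  constructor
  · intro h
    -- Both `ρ` and `rho n μ ℓ` list the complement of the exponents of `μ` in increasing order.
    have hcompl : ∀ ρ, Function.Injective (pairIndex n ℓ μ ρ) →
        Set.range (fun i => pairIndex n ℓ μ ρ (Sum.inr i)) =
          (Set.range fun j : Fin n => (⟨colIndex n ℓ μ j, colIndex_lt μ j⟩ : Fin (n + ℓ)))ᶜ := by
      intro ρ hi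
      have hs : Function.Surjective (pairIndex n ℓ μ ρ) :=
        ((Fintype.bijective_iff_injective_and_card _).2 ⟨hi, by simp⟩).2
      ext x
      constructor
      · rintro ⟨i, rfl⟩ ⟨j, hj⟩
        exact Sum.inl_ne_inr (hi (show pairIndex n ℓ μ ρ (Sum.inl j) = _ from hj))
      · intro hx
        obtain ⟨j | i, rfl⟩ := hs x
        · exact absurd ⟨j, rfl⟩ hx
        · exact ⟨i, rfl⟩
    have hmono : ∀ ρ, ρ ≤ rect n ℓ → StrictMono fun i => pairIndex n ℓ μ ρ (Sum.inr i) :=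
      fun ρ hρ a b hab => strictMono_colIndex hρ hab
    have heq := (StrictMono.range_inj (hmono ρ hρ) (hmono _ (rho_le_rect n μ ℓ))).1
      ((hcompl ρ h).trans (hcompl _ hrho).symm)
    refine ext_cols hρ (rho_le_rect n μ ℓ) (funext fun i => ?_)
    have h1 : colIndex ℓ n ρ i = colIndex ℓ n (rho n μ ℓ) i :=
      congrArg Fin.val (congrFun heq i)
    have h2 := cols_le hρ i
    have h3 := cols_le (rho_le_rect n μ ℓ) i
    simp only [colIndex] at h1
    omega
  · rintro rfl
    exact hrho

open Classical in
/-- The exponents of `μ` and `ρ` are complementary exactly when `ρ` is the conjugate of the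
complement of `μ`; the sign of the corresponding shuffle is `(-1) ^ |ρ|`. -/
theorem coeffDet_S_colExponent {R : Type*} [CommRing R] [Nontrivial R] {n ℓ : ℕ}
    {μ ρ : YoungDiagram} (hμ : μ ≤ rect ℓ n) (hρ : ρ ≤ rect n ℓ) :
    coeffDet R n ℓ (Sum.elim (fun j => S R (colExponent n ℓ μ j))
      fun i => S R (colExponent ℓ n ρ i)) =
      if ρ = rho n μ ℓ then ∏ i, (-1) ^ cols ℓ ρ i else 0 := by
  have hidx : (Sum.elim (fun j => S R (colExponent n ℓ μ j))
      fun i => S R (colExponent ℓ n ρ i)) = fun b => S R ((pairIndex n ℓ μ ρ b : ℕ) : ℤ) := by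
    ext1 (j | i)
    · rw [Sum.elim_inl, colExponent_eq hμ]
      rfl
    · rw [Sum.elim_inr, colExponent_eq hρ]
      rfl
  rw [hidx]
  split_ifs with h
  · have hi := (injective_pairIndex_iff hμ hρ).2 h
    have hb := (Fintype.bijective_iff_injective_and_card _).2 ⟨hi, by simp⟩
    let σ : Equiv.Perm (Fin n ⊕ Fin ℓ) := (Equiv.ofBijective _ hb).trans finSumFinEquiv.symm
    have hσ : ∀ b, finSumFinEquiv (σ b) = pairIndex n ℓ μ ρ b := fun b => by simp [σ]
    have hsign := coeffDet_S_perm (R := R) σ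
    simp only [hσ] at hsign
    rw [hsign, sign_of_strictMono_blocks σ]
    · simp only [hσ]
      push_cast
      refine prod_congr rfl fun i _ => ?_
      congr 1
      subst h
      have hset : (univ.filter fun j : Fin n => pairIndex n ℓ μ (rho n μ ℓ) (Sum.inr i) <
          pairIndex n ℓ μ (rho n μ ℓ) (Sum.inl j)) =
          univ.filter fun j : Fin n => ¬ (j : ℕ) < μ.rowLen (ℓ - 1 - i) := by
        refine filter_congr fun j _ => ⟨fun hlt hj => ?_, fun hj => ?_⟩
        · exact lt_asymm (colIndex_lt_colIndex_rho hμ j i hj) hlt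
        · exact colIndex_rho_lt_colIndex hμ j i hj
      have hcard := card_filter_add_card_filter_not (s := (univ : Finset (Fin n)))
        fun j : Fin n => (j : ℕ) < μ.rowLen (ℓ - 1 - i)
      have hle := rowLen_le hμ (ℓ - 1 - i)
      rw [Fin.card_filter_val_lt, card_univ, Fintype.card_fin] at hcard
      rw [hset, cols_rho]
      omega
    · simp only [hσ]
      exact fun a b hab => strictMono_colIndex hμ hab
    · simp only [hσ]
      exact fun a b hab => strictMono_colIndex hρ hab
  · have hi := mt (injective_pairIndex_iff hμ hρ).1 h
    rw [Function.Injective] at hi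
    push Not at hi
    obtain ⟨a, b, hab, hne⟩ := hi
    exact (coeffDet R n ℓ).map_eq_zero_of_eq _ (by rw [hab]) hne

/-! ### Expansion of the resultant -/

/-- The sign `(-1) ^ c` in a ring, for an integer `c`. -/
def ringSign (R : Type*) [CommRing R] (c : ℤ) : R := ((c.negOnePow : ℤ) : R)

theorem ringSign_add (a b : ℤ) : ringSign R (a + b) = ringSign R a * ringSign R b := by
  simp [ringSign, Int.negOnePow_add]

theorem ringSign_two_mul (a : ℤ) : ringSign R (2 * a) = 1 := by
  simp [ringSign, Int.negOnePow_two_mul]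

theorem ringSign_one : ringSign R 1 = -1 := by
  simp [ringSign]

theorem ringSign_natCast (k : ℕ) : ringSign R k = (-1) ^ k := by
  simp [ringSign, Int.negOnePow_def]

theorem ringSign_mul_self (a : ℤ) : ringSign R a * ringSign R a = 1 := by
  rw [← ringSign_add, ← two_mul, ringSign_two_mul]

/-- The Chebyshev polynomials with alternating signs: they satisfy the same recurrence with `-X` in
place of `X`. -/
noncomputable def signedS (R : Type*) [CommRing R] (c : ℤ) : R[X] := ringSign R c • S R c

theorem neg_X_mul_signedS (c : ℤ) : -X * signedS R c = signedS R (c + 1) + signedS R (c - 1) := by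
  have h1 : ringSign R (c + 1) = -ringSign R c := by rw [ringSign_add, ringSign_one, mul_neg_one]
  have h2 : ringSign R (c - 1) = -ringSign R c := by
    have := ringSign_add (R := R) (c - 1) 1
    rw [sub_add_cancel, ringSign_one] at this
    rw [this]
    ring
  rw [signedS, signedS, signedS, h1, h2, Chebyshev.S_add_one]
  simp only [smul_eq_C_mul, C_neg]
  ring

open Classical in
theorem coeffDet_S_signedS [Nontrivial R] {n ℓ : ℕ} {μ ρ : YoungDiagram} (hμ : μ ≤ rect ℓ n)
    (hρ : ρ ≤ rect n ℓ) :
    coeffDet R n ℓ (Sum.elim (fun j => S R (colExponent n ℓ μ j))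
      fun i => signedS R (colExponent ℓ n ρ i)) =
      if ρ = rho n μ ℓ then ∏ i : Fin ℓ, ringSign R (n + (i : ℕ)) else 0 := by
  have h : coeffDet R n ℓ (Sum.elim (fun j => S R (colExponent n ℓ μ j))
      fun i => signedS R (colExponent ℓ n ρ i)) =
      (∏ i : Fin ℓ, ringSign R (colExponent ℓ n ρ i)) * coeffDet R n ℓ
        (Sum.elim (fun j => S R (colExponent n ℓ μ j)) fun i => S R (colExponent ℓ n ρ i)) :=
    (fixLeft (coeffDet R n ℓ) fun j => S R (colExponent n ℓ μ j)).map_smul_univ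
      (fun i => ringSign R (colExponent ℓ n ρ i)) fun i => S R (colExponent ℓ n ρ i)
  rw [h, coeffDet_S_colExponent hμ hρ]
  split_ifs
  · rw [← prod_mul_distrib]
    refine prod_congr rfl fun i _ => ?_
    rw [← ringSign_natCast, ← ringSign_add, colExponent]
    congr 1
    ring
  · rw [mul_zero]

/-- Expansion of `S (c 0) ∧ ⋯ ∧ q S 0 ∧ ⋯ ∧ q S (ℓ - 1)`, where the first block consists of the
exponents of `μ`: only the conjugate complement of `μ` contributes. -/
theorem coeffDet_S_mul_S [Nontrivial R] {n ℓ : ℕ} {w : ℕ → R}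
    (hw : ∀ a, w (2 * a) * w (2 * a + 1) = 1) {μ : YoungDiagram} (hμ : μ ≤ rect ℓ n) :
    coeffDet R n ℓ (Sum.elim (fun j => S R (colExponent n ℓ μ j))
      fun i => (∏ a ∈ range n, (X - C (w (2 * a) + w (2 * a + 1)))) * S R (i : ℕ)) =
      kingSum w (2 * n) (rho n μ ℓ) := by
  classical
  set q' : R[X] := ∏ a ∈ range n, (-X + algebraMap R R[X] (w (2 * a) + w (2 * a + 1))) with hq'
  have hq : ∏ a ∈ range n, (X - C (w (2 * a) + w (2 * a + 1))) = ringSign R n • q' := by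
    rw [hq', ringSign_natCast, smul_eq_C_mul, C_pow, C_neg, C_1]
    nth_rw 2 [← card_range n]
    rw [← prod_const, ← prod_mul_distrib]
    refine prod_congr rfl fun a _ => ?_
    rw [← C_eq_algebraMap]
    ring
  have hterm : ∀ i : ℕ, (∏ a ∈ range n, (X - C (w (2 * a) + w (2 * a + 1)))) * S R i =
      ringSign R (n + i) • (q' * signedS R i) := by
    intro i
    rw [hq, signedS, mul_smul_comm, smul_smul, ringSign_add, mul_assoc, ringSign_mul_self, mul_one,
      smul_mul_assoc]
  simp only [hterm]
  set Ω := fixLeft (coeffDet R n ℓ) fun j => S R (colExponent n ℓ μ j) with hΩ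
  change Ω (fun i : Fin ℓ => ringSign R (n + (i : ℕ)) • (q' * signedS R (i : ℕ))) = _
  rw [Ω.map_smul_univ, map_prod_mul_eq_sum_boxed (by simp [signedS])
    (fun c _ => neg_X_mul_signedS c) hw, sum_eq_single (rho n μ ℓ)]
  · rw [hΩ, fixLeft_apply, coeffDet_S_signedS hμ (rho_le_rect n μ ℓ), if_pos rfl, smul_eq_mul,
      mul_left_comm, ← prod_mul_distrib]
    simp [ringSign_mul_self]
  · intro ρ hρ hne
    rw [hΩ, fixLeft_apply, coeffDet_S_signedS hμ (mem_boxed.1 hρ), if_neg hne, mul_zero]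
  · exact fun h => absurd (mem_boxed.2 (rho_le_rect n μ ℓ)) h

/-- The resultant of `∏ a, (X - v (2 a) - v (2 a + 1))` and `∏ a, (X + w (2 a) + w (2 a + 1))`,
expanded along both blocks of columns of the Sylvester matrix. -/
theorem prod_add_eq_sum_kingSum_mul_kingSum [Nontrivial R] (n ℓ : ℕ) {v w : ℕ → R}
    (hv : ∀ a, v (2 * a) * v (2 * a + 1) = 1) (hw : ∀ a, w (2 * a) * w (2 * a + 1) = 1) :
    ∏ i : Fin n, ∏ j : Fin ℓ, (v (2 * i) + v (2 * i + 1) + (w (2 * j) + w (2 * j + 1))) =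
      ∑ μ ∈ boxed ℓ n, kingSum w (2 * ℓ) μ * kingSum v (2 * n) (rho n μ ℓ) := by
  rw [← resultant_prod_eq (fun i : Fin n => v (2 * i) + v (2 * i + 1))
    fun j : Fin ℓ => w (2 * j) + w (2 * j + 1)]
  have hp : (∏ j : Fin ℓ, (X + C (w (2 * j) + w (2 * j + 1)))).natDegree ≤ ℓ :=
    (natDegree_prod_le _ _).trans (by simp only [natDegree_X_add_C]; simp)
  have hq : (∏ i : Fin n, (X - C (v (2 * i) + v (2 * i + 1)))).natDegree ≤ n :=
    (natDegree_prod_le _ _).trans (by simp only [natDegree_X_sub_C]; simp)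
  rw [← coeffDet_mul_S hp hq,
    Fin.prod_univ_eq_prod_range (fun a => X + C (w (2 * a) + w (2 * a + 1))),
    Fin.prod_univ_eq_prod_range (fun a => X - C (v (2 * a) + v (2 * a + 1))), ← fixRight_apply]
  have h := map_prod_mul_eq_sum_boxed (i := ℓ) (t := (X : R[X])) (e := S R)
    (Chebyshev.S_neg_one R) (fun c _ => by rw [Chebyshev.S_add_one]; ring) hw
    (fixRight (coeffDet R n ℓ) fun i : Fin ℓ =>
      (∏ a ∈ range n, (X - C (v (2 * a) + v (2 * a + 1)))) * S R (i : ℕ))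
  refine Eq.trans h (sum_congr rfl fun μ hμ => ?_)
  rw [fixRight_apply, coeffDet_S_mul_S hv (mem_boxed.1 hμ)]

end SymplecticCauchy

theorem mainTheorem6 (n ℓ : ℕ) (hn : 1 ≤ n) (hℓ : 1 ≤ ℓ)
    {R : Type*} [CommRing R] (x : Fin n → Rˣ) (z : Fin ℓ → Rˣ) :
    ∏ i : Fin n, ∏ j : Fin ℓ,
        ((x i : R) + ((x i)⁻¹ : Rˣ) + (z j : R) + ((z j)⁻¹ : Rˣ)) =
      ∑ μ : {μ : YoungDiagram // μ ≤ SymplecticCauchy.rect ℓ n},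
        SymplecticCauchy.sp (SymplecticCauchy.rho n μ ℓ) x * SymplecticCauchy.sp (μ : YoungDiagram) z := by
  rcases subsingleton_or_nontrivial R with _ | _
  · exact Subsingleton.elim _ _
  have hweight : ∀ {m : ℕ} (y : Fin m → Rˣ) (a : ℕ),
      ((SymplecticCauchy.letterWeight y (2 * a) : Rˣ) : R) *
        (SymplecticCauchy.letterWeight y (2 * a + 1) : Rˣ) = 1 := by
    intro m y a
    rw [← Units.val_mul, SymplecticCauchy.letterWeight_mul_succ, Units.val_one]
  have h := SymplecticCauchy.prod_add_eq_sum_kingSum_mul_kingSum n ℓ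
    (v := fun a => ((SymplecticCauchy.letterWeight x a : Rˣ) : R))
    (w := fun a => ((SymplecticCauchy.letterWeight z a : Rˣ) : R)) (hweight x) (hweight z)
  simp only [SymplecticCauchy.letterWeight_two_mul,
    SymplecticCauchy.letterWeight_two_mul_add_one] at h
  simp only [add_assoc] at h ⊢
  rw [h, SymplecticCauchy.boxed, Finset.sum_map]
  refine Finset.sum_congr rfl fun μ _ => ?_
  rw [SymplecticCauchy.sp_eq_kingSum, SymplecticCauchy.sp_eq_kingSum, mul_comm]
  rfl
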